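/- Let $\mathbb O=\mathbb H\oplus\mathbb H$ be the octonions, with multiplication $(q_1,q_2)(p_1,p_2)=(q_1p_1-\bar p_2q_2,\;p_2q_1+q_2\bar p_1)$, and identify $\mathbb O\times\mathbb O$ with $\mathbb R^{16}$. Let $U_1=\{1\}\times\mathbb O\times\mathbb O$, $U_2=\mathbb O\times\{1\}\times\mathbb O$, $U_3=\mathbb O\times\mathbb O\times\{1\}$ and $\mathcal U=U_1\cup U_2\cup U_3\subset\mathbb O^3$. On $\mathcal U$ let $(a,b,c)\sim(d,e,f)$ if and only if there is $\lambda\in\mathbb O\setminus\{0\}$ with $a=d\lambda$, $b=e\lambda$, $c=f\lambda$; this is an equivalence relation. Let $\mathbb O\mathrm P^2=\mathcal U/{\sim}$ be the octonionic projective plane, with the quotient topology, let $[a,b,c]$ denote the class of $(a,b,c)$, and let $U_i/{\sim}$ be the image of $U_i$. Then $\mathbb O\mathrm P^2$ is a simply connected smooth manifold of dimension $16$ (Hausdorff and second countable). More precisely: 1. The sets $U_i/{\sim}$ ($i=1,2,3$) are open and cover $\mathbb O\mathrm P^2$, and the maps $\phi_i:U_i/{\sim}\to\mathbb R^{16}$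 given by $\phi_1([1,b,c])=(b,c)$, $\phi_2([a,1,c])=(a,c)$, $\phi_3([a,b,1])=(a,b)$ are well-defined homeomorphisms onto $\mathbb R^{16}$. 2. The transition maps are $$\phi_1\circ\phi_2^{-1}(a,b)=\phi_2\circ\phi_1^{-1}(a,b)=(a^{-1},ba^{-1})\quad(a\neq0),$$ $$\phi_1\circ\phi_3^{-1}(a,b)=(ba^{-1},a^{-1})\quad(a\ne0),\qquad \phi_3\circ\phi_1^{-1}(a,b)=(b^{-1},ab^{-1})\quad(b\neq0),$$ $$\phi_2\circ\phi_3^{-1}(a,b)=\phi_3\circ\phi_2^{-1}(a,b)=(ab^{-1},b^{-1})\quad(b\neq0),$$ each with exactly the indicated domain, and the three charts $\phi_i$ form a smooth atlas of $\mathbb O\mathrm P^2$. 3. $\mathbb O\mathrm P^2$ is simply connected. 4. $U_1/{\sim}\cap U_2/{\sim}$ is homotopy equivalent to $S^7\times\mathbb R^8$, $U_1/{\sim}\cap U_2/{\sim}\cap U_3/{\sim}$ is homotopy equivalent to $S^7\times S^7$, and $(U_1/{\sim}\cup U_2/{\sim})\cap U_3/{\sim}$ is homotopy equivalent to $S^{15}$.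 -/

import Mathlib

open scoped Quaternion Manifold ContDiff

noncomputable section

/-- The octonions `𝕆 = ℍ ⊕ ℍ`, obtained from the quaternions by the Cayley-Dickson construction. -/
@[ext]
structure Octonion where
  /-- first quaternionic component -/
  fst : ℍ[ℝ]
  /-- second quaternionic component -/
  snd : ℍ[ℝ]

namespace Octonion

instance : Zero Octonion := ⟨⟨0, 0⟩⟩

instance : One Octonion := ⟨⟨1, 0⟩⟩

/-- `(q₁, q₂) * (p₁, p₂) = (q₁ p₁ - p̄₂ q₂, p₂ q₁ + q₂ p̄₁)`. -/
instance : Mul Octonion :=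
  ⟨fun q p => ⟨q.fst * p.fst - star p.snd * q.snd, p.snd * q.fst + q.snd * star p.fst⟩⟩

/-- The squared norm `|(q₁, q₂)|² = |q₁|² + |q₂|²`. -/
def normSq (q : Octonion) : ℝ := Quaternion.normSq q.fst + Quaternion.normSq q.snd

/-- `q⁻¹ = q̄ / |q|²`, where the conjugate of `(q₁, q₂)` is `(q̄₁, -q₂)`; in particular `0⁻¹ = 0`. -/
instance : Inv Octonion :=
  ⟨fun q => ⟨(normSq q)⁻¹ • star q.fst, -((normSq q)⁻¹ • q.snd)⟩⟩

/-- The topology of `ℍ × ℍ = ℝ⁸`. -/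
instance : TopologicalSpace Octonion :=
  TopologicalSpace.induced (fun q => (q.fst, q.snd)) inferInstance

theorem zero_def : (0 : Octonion) = ⟨0, 0⟩ := rfl

theorem one_def : (1 : Octonion) = ⟨1, 0⟩ := rfl

theorem mul_def (q p : Octonion) : q * p =
    ⟨q.fst * p.fst - star p.snd * q.snd, p.snd * q.fst + q.snd * star p.fst⟩ := rfl

theorem inv_def (q : Octonion) :
    q⁻¹ = ⟨(normSq q)⁻¹ • star q.fst, -((normSq q)⁻¹ • q.snd)⟩ := rfl

protected theorem one_mul (a : Octonion) : 1 * a = a := by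
  ext1 <;> simp [one_def, mul_def]

protected theorem mul_one (a : Octonion) : a * 1 = a := by
  ext1 <;> simp [one_def, mul_def]

protected theorem zero_mul (a : Octonion) : 0 * a = 0 := by
  ext1 <;> simp [zero_def, mul_def]

protected theorem mul_zero (a : Octonion) : a * 0 = 0 := by
  ext1 <;> simp [zero_def, mul_def]

theorem one_ne_zero : (1 : Octonion) ≠ 0 := by
  intro h
  simpa [one_def, zero_def] using congrArg (fun q => q.fst.re) h

theorem normSq_ne_zero {a : Octonion} (ha : a ≠ 0) : normSq a ≠ 0 := by
  intro h
  apply ha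
  have h1 : 0 ≤ Quaternion.normSq a.fst := Quaternion.normSq_nonneg
  have h2 : 0 ≤ Quaternion.normSq a.snd := Quaternion.normSq_nonneg
  unfold normSq at h
  ext1
  · exact Quaternion.normSq_eq_zero.1 (by linarith)
  · exact Quaternion.normSq_eq_zero.1 (by linarith)

theorem normSq_eq (a : Octonion) : normSq a =
    a.fst.re ^ 2 + a.fst.imI ^ 2 + a.fst.imJ ^ 2 + a.fst.imK ^ 2 +
      (a.snd.re ^ 2 + a.snd.imI ^ 2 + a.snd.imJ ^ 2 + a.snd.imK ^ 2) := by
  simp [normSq, Quaternion.normSq_def']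

/-- Right cancellation `(a b) b⁻¹ = a`. -/
theorem mul_mul_inv {b : Octonion} (hb : b ≠ 0) (a : Octonion) : a * b * b⁻¹ = a := by
  have h := normSq_ne_zero hb
  have e := normSq_eq b
  ext <;> simp [mul_def, inv_def] <;> field_simp <;> rw [e] <;> ring

/-- Left cancellation `b⁻¹ (b a) = a`. -/
theorem inv_mul_mul {b : Octonion} (hb : b ≠ 0) (a : Octonion) : b⁻¹ * (b * a) = a := by
  have h := normSq_ne_zero hb
  have e := normSq_eq b
  ext <;> simp [mul_def, inv_def] <;> field_simp <;> rw [e] <;> ring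

theorem mul_ne_zero {a b : Octonion} (ha : a ≠ 0) (hb : b ≠ 0) : a * b ≠ 0 := by
  intro h
  apply ha
  rw [← mul_mul_inv hb a, h, Octonion.zero_mul]

theorem mul_inv_self {b : Octonion} (hb : b ≠ 0) : b * b⁻¹ = 1 := by
  simpa [Octonion.one_mul] using mul_mul_inv hb 1

theorem inv_ne_zero {b : Octonion} (hb : b ≠ 0) : b⁻¹ ≠ 0 := by
  intro h
  have := mul_inv_self hb
  rw [h, Octonion.mul_zero] at this
  exact one_ne_zero this.symm

theorem eq_inv_of_mul_eq_one {a b : Octonion} (hb : b ≠ 0) (h : a * b = 1) : a = b⁻¹ := by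
  rw [← mul_mul_inv hb a, h, Octonion.one_mul]

theorem normSq_mul (a b : Octonion) : normSq (a * b) = normSq a * normSq b := by
  rw [normSq_eq, normSq_eq, normSq_eq]
  simp [mul_def]
  ring

theorem mul_inv_rev (a b : Octonion) : (a * b)⁻¹ = b⁻¹ * a⁻¹ := by
  ext <;> simp [inv_def, normSq_mul] <;> simp [mul_def] <;> ring

theorem inv_inv_mul {a b : Octonion} (ha : a ≠ 0) (hb : b ≠ 0) :
    (b⁻¹ * a⁻¹) * (a * b) = 1 := by
  rw [← mul_inv_rev]
  simpa [Octonion.mul_one] using inv_mul_mul (mul_ne_zero ha hb) 1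

end Octonion

namespace OctPlane

open Octonion

/-- The relation `[a, b, c] ∼ [d, e, f]` on `𝕆³`: there is `l ≠ 0` with
`a = d l`, `b = e l`, `c = f l`. -/
def Rel (x y : Fin 3 → Octonion) : Prop :=
  ∃ l : Octonion, l ≠ 0 ∧ ∀ i, x i = y i * l

/-- The sets `U₁ = {1} × 𝕆 × 𝕆`, `U₂ = 𝕆 × {1} × 𝕆`, `U₃ = 𝕆 × 𝕆 × {1}`,
with indices shifted to `0, 1, 2`. -/
def U (i : Fin 3) : Set (Fin 3 → Octonion) := {x | x i = 1}

/-- The union `𝒰 = U₁ ∪ U₂ ∪ U₃`, a subspace of `𝕆³`. -/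
abbrev Reduced : Type := ↥(⋃ i, U i)

/-- The relation `∼` is an equivalence relation on `𝒰`. -/
theorem rel_equivalence : Equivalence (fun x y : Reduced => Rel x.1 y.1) := by
  refine ⟨fun x => ⟨1, one_ne_zero, fun i => (Octonion.mul_one _).symm⟩, ?_, ?_⟩
  · rintro x y ⟨l, hl, h⟩
    exact ⟨l⁻¹, inv_ne_zero hl, fun i => by rw [h i, mul_mul_inv hl]⟩
  · rintro ⟨x, hx⟩ ⟨y, hy⟩ ⟨z, hz⟩ ⟨l, hl, h⟩ ⟨m, hm, h'⟩
    simp only [U, Set.mem_iUnion, Set.mem_ofPred_eq] at hx hy hz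
    simp only at h h'
    obtain ⟨k, hk⟩ := hx
    obtain ⟨j, hj⟩ := hy
    obtain ⟨i, hi⟩ := hz
    refine ⟨m * l, mul_ne_zero hm hl, fun n => ?_⟩
    change x n = z n * (m * l)
    rw [h n, h' n]
    rw [h' j] at hj
    rw [h k, h' k] at hk
    have hcases : n = i ∨ n = j ∨ n = k ∨ i = j ∨ i = k ∨ j = k := by
      clear * -
      revert n i j k
      decide
    rcases hcases with rfl | rfl | rfl | rfl | rfl | rfl
    · rw [hi, Octonion.one_mul, Octonion.one_mul]
    · rw [hj, Octonion.one_mul, eq_inv_of_mul_eq_one hm hj, inv_mul_mul hm]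
    · rw [hk]
      have e : z n * m = l⁻¹ := eq_inv_of_mul_eq_one hl hk
      have e' : z n = l⁻¹ * m⁻¹ := by rw [← e, mul_mul_inv hm]
      rw [e', inv_inv_mul hm hl]
    · rw [hi, Octonion.one_mul] at hj
      rw [hj, Octonion.mul_one, Octonion.one_mul]
    · rw [hi, Octonion.one_mul] at hk
      have e : l = m⁻¹ := by rw [← inv_mul_mul hm l, hk, Octonion.mul_one]
      rw [hk, Octonion.mul_one, e, mul_mul_inv hm]
    · rw [hj, Octonion.one_mul] at hk
      rw [hk, Octonion.mul_one, Octonion.mul_one]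

/-- The equivalence relation `∼` on `𝒰`. -/
instance relSetoid : Setoid Reduced := ⟨fun x y => Rel x.1 y.1, rel_equivalence⟩

/-- The octonionic projective plane `𝕆P² = 𝒰 / ∼`. -/
def OP2 : Type := Quotient relSetoid

/-- The quotient topology. The three sets `Uᵢ` are closed in `𝒰` and cover it, so this is the same
as the topology glued from the three charts: `V` is open if and only if its preimage in
every `Uᵢ = 𝕆²` is open. -/
instance : TopologicalSpace OP2 := inferInstanceAs (TopologicalSpace (Quotient relSetoid))

/-- The class `[x 0, x 1, x 2]` of a triple that has some entry equal to `1`. -/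
def OP2.mk (x : Fin 3 → Octonion) (hx : ∃ i, x i = 1) : OP2 :=
  Quotient.mk relSetoid ⟨x, Set.mem_iUnion.2 hx⟩

/-- The subset `Uᵢ / ∼` of `𝕆P²`. -/
def dom (i : Fin 3) : Set OP2 := {p | ∃ (x : Fin 3 → Octonion) (hx : x i = 1), p = OP2.mk x ⟨i, hx⟩}

/-- The identification `𝕆 × 𝕆 = ℝ¹⁶` through the real coordinates of the quaternionic components. -/
def toR16 (a b : Octonion) : EuclideanSpace ℝ (Fin 16) :=
  !₂[a.fst.re, a.fst.imI, a.fst.imJ, a.fst.imK, a.snd.re, a.snd.imI, a.snd.imJ, a.snd.imK,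
     b.fst.re, b.fst.imI, b.fst.imJ, b.fst.imK, b.snd.re, b.snd.imI, b.snd.imJ, b.snd.imK]

/-- The map `f` between octonionic pairs, defined on the set `D` of octonionic pairs, is
the transition function from the chart `ψ` to the chart `φ` (i.e. `φ ∘ ψ⁻¹`), and `D` is its
exact domain of definition. -/
def IsTransition (φ ψ : OpenPartialHomeomorph OP2 (EuclideanSpace ℝ (Fin 16)))
    (D : Octonion → Octonion → Prop) (f : Octonion → Octonion → Octonion × Octonion) : Prop :=
  ∀ a b : Octonion, (toR16 a b ∈ (ψ.symm.trans φ).source ↔ D a b) ∧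
    (D a b → φ (ψ.symm (toR16 a b)) = toR16 (f a b).1 (f a b).2)

end OctPlane

end

open OctPlane

section SimplyConnected

open Set unitInterval

variable {X : Type*} [TopologicalSpace X]

/-- Two paths inside a simply connected set with the same endpoints are homotopic. -/
theorem IsSimplyConnected.homotopic_of_mem {s : Set X} (hs : IsSimplyConnected s) {x y : X}
    (p q : Path x y) (hp : ∀ t, p t ∈ s) (hq : ∀ t, q t ∈ s) : p.Homotopic q := by
  have := hs.simplyConnectedSpace
  have hx : x ∈ s := by simpa using hp 0
  have hy : y ∈ s := by simpa using hp 1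
  let p' : Path (⟨x, hx⟩ : s) ⟨y, hy⟩ :=
    { toFun := fun t => ⟨p t, hp t⟩, source' := by simp, target' := by simp }
  let q' : Path (⟨x, hx⟩ : s) ⟨y, hy⟩ :=
    { toFun := fun t => ⟨q t, hq t⟩, source' := by simp, target' := by simp }
  exact (SimplyConnectedSpace.paths_homotopic p' q').map (.restrict s (.id _))

/-- A space covered by simply connected open sets with path connected pairwise intersections and
a common point is simply connected. -/
theorem simplyConnectedSpace_of_isOpen_cover {ι : Type*} {V : ι → Set X}
    (ho : ∀ i, IsOpen (V i)) (hV : ∀ x, ∃ i, x ∈ V i) (hs : ∀ i, IsSimplyConnected (V i))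
    (hp : ∀ i j, IsPathConnected (V i ∩ V j)) (x₀ : X) (hx₀ : ∀ i, x₀ ∈ V i) :
    SimplyConnectedSpace X := by
  choose k hk using hV
  have hc : ∀ x, ∃ c : Path x₀ x, ∀ t, c t ∈ V (k x) := fun x =>
    let h := (hs (k x)).isPathConnected.joinedIn x₀ (hx₀ _) x (hk x)
    ⟨h.somePath, h.somePath_mem⟩
  choose c hc using hc
  have hconst : ∀ j x (δ : Path x₀ x), (∀ t, δ t ∈ V j) → (c x).Homotopic δ := by
    intro j x δ hδ
    have hx : x ∈ V j := by simpa using hδ 1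
    have h := (hp (k x) j).joinedIn x₀ ⟨hx₀ _, hx₀ _⟩ x ⟨hk x, hx⟩
    exact ((hs (k x)).homotopic_of_mem _ h.somePath (hc x) fun t => (h.somePath_mem t).1).trans
      ((hs j).homotopic_of_mem h.somePath δ (fun t => (h.somePath_mem t).2) hδ)
  have hstep : ∀ j x y (δ : Path x y), (∀ t, δ t ∈ V j) → ((c x).trans δ).Homotopic (c y) := by
    intro j x y δ hδ
    have hx : x ∈ V j := by simpa using hδ 0
    have h := (hs j).isPathConnected.joinedIn x₀ (hx₀ _) x hx
    have h1 : ((c x).trans δ).Homotopic (h.somePath.trans δ) :=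
      (hconst j x h.somePath h.somePath_mem).hcomp (.refl δ)
    refine h1.trans (hconst j y _ fun t => ?_).symm
    have : h.somePath.trans δ t ∈ range (h.somePath.trans δ) := mem_range_self t
    rw [Path.trans_range] at this
    rcases this with ⟨s, hs⟩ | ⟨s, hs⟩
    · exact hs ▸ h.somePath_mem s
    · exact hs ▸ hδ s
  have hcast : ∀ {a b x y : X} (ha : a = x) (hb : b = y) (γ : Path x y),
      ((c a).trans (γ.cast ha hb)).Homotopic (c b) → ((c x).trans γ).Homotopic (c y) := by
    rintro a b x y rfl rfl γ h
    exact h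
  have hall : ∀ {x y : X} (γ : Path x y), ((c x).trans γ).Homotopic (c y) := by
    intro x y γ
    obtain ⟨t, ht0, hmono, ⟨n, hn⟩, hsub⟩ := exists_monotone_Icc_subset_open_cover_unitInterval
      (c := fun i => γ ⁻¹' V i) (fun i => (ho i).preimage γ.continuous)
      (fun s _ => mem_iUnion.2 ⟨k (γ s), hk _⟩)
    have key : ∀ m, ((c (γ 0)).trans (γ.subpath 0 (t m))).Homotopic (c (γ (t m))) := by
      intro m
      induction m with
      | zero =>
        rw [ht0, Path.subpath_self]
        exact ⟨Path.Homotopy.transRefl _⟩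
      | succ m ih =>
        obtain ⟨i, hi⟩ := hsub m
        have h1 : ((γ.subpath 0 (t m)).trans (γ.subpath (t m) (t (m + 1)))).Homotopic
            (γ.subpath 0 (t (m + 1))) := ⟨Path.Homotopy.subpathTransSubpath γ _ _ _⟩
        have h2 := hstep i _ _ (γ.subpath (t m) (t (m + 1))) fun s => by
          have : γ.subpath (t m) (t (m + 1)) s ∈ range (γ.subpath (t m) (t (m + 1))) :=
            mem_range_self s
          rw [Path.range_subpath_of_le _ _ _ (hmono m.le_succ)] at this
          obtain ⟨r, hr, hrs⟩ := this
          exact hrs ▸ hi hr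
        exact ((Path.Homotopic.refl _).hcomp h1.symm).trans
          (Path.Homotopic.trans ⟨(Path.Homotopy.transAssoc _ _ _).symm⟩
            ((ih.hcomp (.refl _)).trans h2))
    have h := key n
    rw [hn n le_rfl, Path.subpath_zero_one] at h
    exact hcast _ _ γ h
  rw [simply_connected_iff_paths_homotopic']
  refine ⟨⟨⟨x₀⟩, fun x y => ⟨(c x).symm.trans (c y)⟩⟩, fun {x y} p q => ?_⟩
  have h := (hall p).trans (hall q).symm
  rw [← Path.Homotopic.Quotient.eq] at h ⊢
  have h' := congrArg (Path.Homotopic.Quotient.trans (Path.Homotopic.Quotient.symm (.mk (c x)))) h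
  simpa [Path.Homotopic.Quotient.mk_trans, ← Path.Homotopic.Quotient.trans_assoc] using h'

end SimplyConnected

namespace Octonion

open Set Topology

theorem inv_zero : (0 : Octonion)⁻¹ = 0 := by
  ext1 <;> simp [inv_def, zero_def]

theorem inv_inv (a : Octonion) : a⁻¹⁻¹ = a := by
  by_cases ha : a = 0
  · rw [ha, inv_zero, inv_zero]
  · exact (eq_inv_of_mul_eq_one (inv_ne_zero ha) (mul_inv_self ha)).symm

theorem inv_one : (1 : Octonion)⁻¹ = 1 :=
  (eq_inv_of_mul_eq_one one_ne_zero (Octonion.mul_one 1)).symm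

theorem mul_inv_mul {b : Octonion} (hb : b ≠ 0) (a : Octonion) : a * b⁻¹ * b = a := by
  simpa only [inv_inv] using mul_mul_inv (inv_ne_zero hb) a

theorem normSq_nonneg (a : Octonion) : 0 ≤ normSq a :=
  add_nonneg Quaternion.normSq_nonneg Quaternion.normSq_nonneg

theorem normSq_one : normSq 1 = 1 := by simp [normSq, one_def]

theorem normSq_zero : normSq 0 = 0 := by simp [normSq, zero_def]

theorem isEmbedding_components : IsEmbedding fun q : Octonion => (q.fst, q.snd) :=
  ⟨⟨rfl⟩, fun _ _ h => Octonion.ext (congrArg Prod.fst h) (congrArg Prod.snd h)⟩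

instance : T2Space Octonion := isEmbedding_components.t2Space

theorem continuous_fst : Continuous Octonion.fst :=
  _root_.continuous_fst.comp isEmbedding_components.continuous

theorem continuous_snd : Continuous Octonion.snd :=
  _root_.continuous_snd.comp isEmbedding_components.continuous

theorem continuous_iff {X : Type*} [TopologicalSpace X] {f : X → Octonion} :
    Continuous f ↔ Continuous (fun x => (f x).fst) ∧ Continuous (fun x => (f x).snd) := by
  rw [isEmbedding_components.continuous_iff, continuous_prodMk.symm]
  rfl

theorem continuousOn_iff {X : Type*} [TopologicalSpace X] {f : X → Octonion} {s : Set X} :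
    ContinuousOn f s ↔
      ContinuousOn (fun x => (f x).fst) s ∧ ContinuousOn (fun x => (f x).snd) s := by
  rw [isEmbedding_components.continuousOn_iff]
  exact ⟨fun h => ⟨h.fst, h.snd⟩, fun h => h.1.prodMk h.2⟩

theorem continuous_normSq : Continuous normSq :=
  (Quaternion.continuous_normSq.comp continuous_fst).add
    (Quaternion.continuous_normSq.comp continuous_snd)

instance : ContinuousMul Octonion where
  continuous_mul := by
    have h1 : Continuous fun p : Octonion × Octonion => p.1.fst :=
      continuous_fst.comp _root_.continuous_fst
    have h2 : Continuous fun p : Octonion × Octonion => p.1.snd :=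
      continuous_snd.comp _root_.continuous_fst
    have h3 : Continuous fun p : Octonion × Octonion => p.2.fst :=
      continuous_fst.comp _root_.continuous_snd
    have h4 : Continuous fun p : Octonion × Octonion => p.2.snd :=
      continuous_snd.comp _root_.continuous_snd
    exact continuous_iff.2 ⟨(h1.mul h3).sub (h4.star.mul h2), (h4.mul h1).add (h2.mul h3.star)⟩

theorem continuousOn_inv : ContinuousOn (fun q : Octonion => q⁻¹) {q | q ≠ 0} := by
  have h : ContinuousOn (fun q : Octonion => (normSq q)⁻¹) {q | q ≠ 0} :=
    continuous_normSq.continuousOn.inv₀ fun q hq => normSq_ne_zero hq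
  exact continuousOn_iff.2 ⟨h.smul continuous_fst.star.continuousOn,
    (h.smul continuous_snd.continuousOn).neg⟩

end Octonion

/-- A quaternion valued function is `Cⁿ` if and only if its four real coordinates are. -/
theorem Quaternion.contDiffOn_iff {E : Type*} [NormedAddCommGroup E] [NormedSpace ℝ E]
    {n : WithTop ℕ∞} {f : E → ℍ[ℝ]} {s : Set E} :
    ContDiffOn ℝ n f s ↔
    ContDiffOn ℝ n (fun x => (f x).re) s ∧ ContDiffOn ℝ n (fun x => (f x).imI) s ∧
      ContDiffOn ℝ n (fun x => (f x).imJ) s ∧ ContDiffOn ℝ n (fun x => (f x).imK) s := by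
  rw [← Quaternion.linearIsometryEquivTuple.toContinuousLinearEquiv.comp_contDiffOn_iff,
    contDiffOn_euclidean]
  simp only [Fin.forall_fin_succ, Fin.forall_fin_zero, and_true]
  rfl

namespace Octonion

variable {E : Type*} [NormedAddCommGroup E] [NormedSpace ℝ E] {n : WithTop ℕ∞} {s : Set E}
  {f g : E → Octonion}

/-- An octonion valued function is `Cⁿ` if its quaternionic components are. -/
def IsContDiffOn (n : WithTop ℕ∞) (f : E → Octonion) (s : Set E) : Prop :=
  ContDiffOn ℝ n (fun x => (f x).fst) s ∧ ContDiffOn ℝ n (fun x => (f x).snd) s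

theorem isContDiffOn_const (a : Octonion) : IsContDiffOn n (fun _ : E => a) s :=
  ⟨contDiffOn_const, contDiffOn_const⟩

theorem contDiffOn_star {q : E → ℍ[ℝ]} (hq : ContDiffOn ℝ n q s) :
    ContDiffOn ℝ n (fun x => star (q x)) s := by
  obtain ⟨h1, h2, h3, h4⟩ := Quaternion.contDiffOn_iff.1 hq
  exact Quaternion.contDiffOn_iff.2 ⟨by simpa using h1, by simpa using h2.neg,
    by simpa using h3.neg, by simpa using h4.neg⟩

theorem IsContDiffOn.mul (hf : IsContDiffOn n f s) (hg : IsContDiffOn n g s) :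
    IsContDiffOn n (fun x => f x * g x) s :=
  ⟨(hf.1.mul hg.1).sub ((contDiffOn_star hg.2).mul hf.2),
    (hg.2.mul hf.1).add (hf.2.mul (contDiffOn_star hg.1))⟩

theorem IsContDiffOn.normSq (hf : IsContDiffOn n f s) :
    ContDiffOn ℝ n (fun x => Octonion.normSq (f x)) s := by
  simp only [Octonion.normSq, Quaternion.normSq_eq_norm_mul_self, ← sq]
  exact (hf.1.norm_sq ℝ).add (hf.2.norm_sq ℝ)

theorem IsContDiffOn.inv (hf : IsContDiffOn n f s) (h0 : ∀ x ∈ s, f x ≠ 0) :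
    IsContDiffOn n (fun x => (f x)⁻¹) s := by
  have h : ContDiffOn ℝ n (fun x => (Octonion.normSq (f x))⁻¹) s :=
    hf.normSq.inv fun x hx => normSq_ne_zero (h0 x hx)
  exact ⟨h.smul (contDiffOn_star hf.1), (h.smul hf.2).neg⟩

theorem IsContDiffOn.toR16 (hf : IsContDiffOn n f s) (hg : IsContDiffOn n g s) :
    ContDiffOn ℝ n (fun x => toR16 (f x) (g x)) s := by
  obtain ⟨h1, h2, h3, h4⟩ := Quaternion.contDiffOn_iff.1 hf.1
  obtain ⟨h5, h6, h7, h8⟩ := Quaternion.contDiffOn_iff.1 hf.2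
  obtain ⟨k1, k2, k3, k4⟩ := Quaternion.contDiffOn_iff.1 hg.1
  obtain ⟨k5, k6, k7, k8⟩ := Quaternion.contDiffOn_iff.1 hg.2
  rw [contDiffOn_euclidean]
  intro i
  fin_cases i <;> assumption

/-- The first octonionic component of a point of `ℝ¹⁶`. -/
noncomputable def leftHalf (v : EuclideanSpace ℝ (Fin 16)) : Octonion :=
  ⟨⟨v 0, v 1, v 2, v 3⟩, ⟨v 4, v 5, v 6, v 7⟩⟩

/-- The second octonionic component of a point of `ℝ¹⁶`. -/
noncomputable def rightHalf (v : EuclideanSpace ℝ (Fin 16)) : Octonion :=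
  ⟨⟨v 8, v 9, v 10, v 11⟩, ⟨v 12, v 13, v 14, v 15⟩⟩

theorem isContDiffOn_leftHalf (s : Set (EuclideanSpace ℝ (Fin 16))) :
    IsContDiffOn n leftHalf s := by
  unfold leftHalf
  constructor <;>
  refine Quaternion.contDiffOn_iff.2 ⟨?_, ?_, ?_, ?_⟩ <;> dsimp <;> fun_prop

theorem isContDiffOn_rightHalf (s : Set (EuclideanSpace ℝ (Fin 16))) :
    IsContDiffOn n rightHalf s := by
  unfold rightHalf
  constructor <;>
  refine Quaternion.contDiffOn_iff.2 ⟨?_, ?_, ?_, ?_⟩ <;> dsimp <;> fun_prop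

theorem toR16_halves (v : EuclideanSpace ℝ (Fin 16)) :
    OctPlane.toR16 (leftHalf v) (rightHalf v) = v := by
  ext i
  fin_cases i <;> rfl

theorem continuous_of_isContDiffOn (hf : IsContDiffOn 0 f Set.univ) : Continuous f :=
  continuous_iff.2 ⟨contDiff_zero.1 (contDiffOn_univ.1 hf.1),
    contDiff_zero.1 (contDiffOn_univ.1 hf.2)⟩

theorem continuous_toR16 : Continuous fun p : Octonion × Octonion => OctPlane.toR16 p.1 p.2 := by
  have h1 := Octonion.continuous_fst
  have h2 := Octonion.continuous_snd
  refine (PiLp.continuous_toLp 2 _).comp (continuous_pi fun i => ?_)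
  have := Quaternion.continuous_re
  have := Quaternion.continuous_imI
  have := Quaternion.continuous_imJ
  have := Quaternion.continuous_imK
  fin_cases i <;> simp <;> fun_prop

/-- The identification `𝕆 × 𝕆 ≃ ℝ¹⁶` as a homeomorphism. -/
noncomputable def prodHomeomorph : Octonion × Octonion ≃ₜ EuclideanSpace ℝ (Fin 16) where
  toFun p := OctPlane.toR16 p.1 p.2
  invFun v := (leftHalf v, rightHalf v)
  left_inv _ := rfl
  right_inv v := toR16_halves v
  continuous_toFun := continuous_toR16
  continuous_invFun := (continuous_of_isContDiffOn (isContDiffOn_leftHalf _)).prodMk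
    (continuous_of_isContDiffOn (isContDiffOn_rightHalf _))

/-- The identification `𝕆 ≃ ℝ⁸` as a homeomorphism. -/
noncomputable def homeomorphEuclidean : Octonion ≃ₜ EuclideanSpace ℝ (Fin 8) where
  toFun a := !₂[a.fst.re, a.fst.imI, a.fst.imJ, a.fst.imK,
    a.snd.re, a.snd.imI, a.snd.imJ, a.snd.imK]
  invFun v := ⟨⟨v 0, v 1, v 2, v 3⟩, ⟨v 4, v 5, v 6, v 7⟩⟩
  left_inv _ := rfl
  right_inv v := by
    ext i
    fin_cases i <;> rfl
  continuous_toFun := by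
    have h1 := Octonion.continuous_fst
    have h2 := Octonion.continuous_snd
    refine (PiLp.continuous_toLp 2 _).comp (continuous_pi fun i => ?_)
    have := Quaternion.continuous_re
    have := Quaternion.continuous_imI
    have := Quaternion.continuous_imJ
    have := Quaternion.continuous_imK
    fin_cases i <;> simp <;> fun_prop
  continuous_invFun := by
    refine continuous_of_isContDiffOn ⟨?_, ?_⟩ <;>
    refine Quaternion.contDiffOn_iff.2 ⟨?_, ?_, ?_, ?_⟩ <;> dsimp <;> fun_prop

theorem homeomorphEuclidean_zero : homeomorphEuclidean 0 = 0 := by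
  ext i
  fin_cases i <;> rfl

theorem prodHomeomorph_zero : prodHomeomorph (0, 0) = 0 := by
  ext i
  fin_cases i <;> rfl

end Octonion

namespace OctPlane

open Octonion Set Topology

theorem exists_eq_one (x : Reduced) : ∃ i, x.1 i = 1 :=
  (mem_iUnion (s := U)).1 x.2

/-- The quotient map `𝒰 → 𝕆P²`. -/
def OP2.proj : Reduced → OP2 := Quotient.mk relSetoid

theorem OP2.mk_surjective (p : OP2) : ∃ x hx, p = OP2.mk x hx := by
  obtain ⟨x, rfl⟩ := Quotient.exists_rep p
  exact ⟨x.1, exists_eq_one x, rfl⟩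

theorem OP2.mk_eq_mk {x y : Fin 3 → Octonion} {hx : ∃ i, x i = 1} {hy : ∃ i, y i = 1} :
    OP2.mk x hx = OP2.mk y hy ↔ Rel x y :=
  Quotient.eq (r := relSetoid)

theorem Rel.apply_eq_zero_iff {x y : Fin 3 → Octonion} (h : Rel x y) (i : Fin 3) :
    x i = 0 ↔ y i = 0 := by
  obtain ⟨l, hl, h⟩ := h
  rw [h i]
  refine ⟨fun h0 => by_contra fun hy => mul_ne_zero hy hl h0, fun h0 => ?_⟩
  rw [h0, Octonion.zero_mul]

theorem rel_normalize {x : Fin 3 → Octonion} {i : Fin 3} (hi : x i ≠ 0) :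
    Rel x fun n => x n * (x i)⁻¹ :=
  ⟨x i, hi, fun _ => (mul_inv_mul hi _).symm⟩

/-- A class has at most one representative with `i`-th entry `1`. -/
theorem Rel.eq_of_apply_eq_one {x y : Fin 3 → Octonion} (h : Rel x y) {i : Fin 3}
    (hx : x i = 1) (hy : y i = 1) : x = y := by
  obtain ⟨l, hl, h⟩ := h
  have hl1 : l = 1 := by rw [← hx, h i, hy, Octonion.one_mul]
  funext n
  rw [h n, hl1, Octonion.mul_one]

theorem normalize_eq {x y : Fin 3 → Octonion} (hx : ∃ i, x i = 1) (hy : ∃ i, y i = 1)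
    (h : Rel x y) (i n : Fin 3) : x n * (x i)⁻¹ = y n * (y i)⁻¹ := by
  by_cases hi : x i = 0
  · rw [hi, (h.apply_eq_zero_iff i).1 hi, inv_zero, Octonion.mul_zero, Octonion.mul_zero]
  have hi' : y i ≠ 0 := fun h0 => hi ((h.apply_eq_zero_iff i).2 h0)
  have hx' : x i * (x i)⁻¹ = 1 := mul_inv_self hi
  have hy' : y i * (y i)⁻¹ = 1 := mul_inv_self hi'
  have h1 : OP2.mk (fun n => x n * (x i)⁻¹) ⟨i, hx'⟩ = OP2.mk (fun n => y n * (y i)⁻¹) ⟨i, hy'⟩ :=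
    (OP2.mk_eq_mk.2 (rel_normalize hi)).symm.trans
      ((OP2.mk_eq_mk (hx := hx) (hy := hy).2 h).trans (OP2.mk_eq_mk.2 (rel_normalize hi')))
  exact congrFun ((OP2.mk_eq_mk.1 h1).eq_of_apply_eq_one hx' hy') n

/-- The `n`-th homogeneous coordinate normalized by the `i`-th one. -/
noncomputable def ratio (i n : Fin 3) : OP2 → Octonion :=
  Quotient.lift (fun x : Reduced => x.1 n * (x.1 i)⁻¹) fun x y h =>
    normalize_eq (exists_eq_one x) (exists_eq_one y) h i n

theorem ratio_mk (i n : Fin 3) (x : Fin 3 → Octonion) (hx : ∃ i, x i = 1) :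
    ratio i n (OP2.mk x hx) = x n * (x i)⁻¹ := rfl

theorem mk_mem_dom {i : Fin 3} {x : Fin 3 → Octonion} {hx : ∃ i, x i = 1} :
    OP2.mk x hx ∈ dom i ↔ x i ≠ 0 := by
  constructor
  · rintro ⟨y, hy, h⟩ h0
    rw [(OP2.mk_eq_mk.1 h).apply_eq_zero_iff, hy] at h0
    exact one_ne_zero h0
  · intro h
    exact ⟨fun n => x n * (x i)⁻¹, mul_inv_self h, OP2.mk_eq_mk.2 (rel_normalize h)⟩

theorem exists_mem_dom (p : OP2) : ∃ i, p ∈ dom i := by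
  obtain ⟨x, ⟨i, hi⟩, rfl⟩ := p.mk_surjective
  exact ⟨i, mk_mem_dom.2 (hi ▸ one_ne_zero)⟩

theorem isQuotientMap_mk : IsQuotientMap OP2.proj :=
  isQuotientMap_quotient_mk'

theorem preimage_dom (i : Fin 3) :
    OP2.proj ⁻¹' dom i = {x | x.1 i ≠ 0} := by
  ext x
  exact mk_mem_dom (hx := exists_eq_one x)

theorem continuous_entry (i : Fin 3) : Continuous fun x : Reduced => x.1 i :=
  (continuous_apply i).comp continuous_subtype_val

theorem isOpen_dom (i : Fin 3) : IsOpen (dom i) := by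
  rw [← isQuotientMap_mk.isOpen_preimage, preimage_dom]
  exact isOpen_compl_singleton.preimage (continuous_entry i)

theorem continuousOn_ratio (i n : Fin 3) : ContinuousOn (ratio i n) (dom i) := by
  rw [isQuotientMap_mk.continuousOn_isOpen_iff (isOpen_dom i), preimage_dom]
  exact (continuous_entry n).continuousOn.mul
    (continuousOn_inv.comp (continuous_entry i).continuousOn fun _ h => h)

/-- The triple with `i`-th entry `1` and the entries of `p` in the remaining places. -/
noncomputable def insertOne (i : Fin 3) (p : Octonion × Octonion) : Fin 3 → Octonion :=
  Fin.insertNth (α := fun _ => Octonion) i 1 ![p.1, p.2]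

theorem insertOne_self (i : Fin 3) (p : Octonion × Octonion) : insertOne i p i = 1 :=
  Fin.insertNth_apply_same (α := fun _ => Octonion) _ _ _

theorem insertOne_succAbove_zero (i : Fin 3) (p : Octonion × Octonion) :
    insertOne i p (i.succAbove 0) = p.1 :=
  Fin.insertNth_apply_succAbove (α := fun _ => Octonion) _ _ _ _

theorem insertOne_succAbove_one (i : Fin 3) (p : Octonion × Octonion) :
    insertOne i p (i.succAbove 1) = p.2 :=
  Fin.insertNth_apply_succAbove (α := fun _ => Octonion) _ _ _ _

theorem insertOne_zero (a b : Octonion) : insertOne 0 (a, b) = ![1, a, b] := by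
  funext n
  fin_cases n <;> rfl

theorem insertOne_one (a b : Octonion) : insertOne 1 (a, b) = ![a, 1, b] := by
  funext n
  fin_cases n <;> rfl

theorem insertOne_two (a b : Octonion) : insertOne 2 (a, b) = ![a, b, 1] := by
  funext n
  fin_cases n <;> rfl

/-- Case distinction over the three entries of `insertOne i`. -/
theorem insertOne_cases (i n : Fin 3) :
    (∀ p, insertOne i p n = 1) ∨ (∀ p, insertOne i p n = p.1) ∨ (∀ p, insertOne i p n = p.2) := by
  rcases Fin.eq_self_or_eq_succAbove i n with rfl | ⟨k, rfl⟩
  · exact .inl (insertOne_self n)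
  · fin_cases k
    · exact .inr (.inl (insertOne_succAbove_zero i))
    · exact .inr (.inr (insertOne_succAbove_one i))

/-- The chart `Uᵢ/∼ → 𝕆 × 𝕆`. -/
noncomputable def octChart (i : Fin 3) : OpenPartialHomeomorph OP2 (Octonion × Octonion) where
  toFun p := (ratio i (i.succAbove 0) p, ratio i (i.succAbove 1) p)
  invFun p := OP2.mk (insertOne i p) ⟨i, insertOne_self i p⟩
  source := dom i
  target := univ
  map_source' _ _ := mem_univ _
  map_target' p _ := ⟨insertOne i p, insertOne_self i p, rfl⟩
  left_inv' := by
    rintro _ ⟨x, hx, rfl⟩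
    refine OP2.mk_eq_mk.2 ⟨1, one_ne_zero, fun n => ?_⟩
    rw [Octonion.mul_one, ratio_mk, ratio_mk, hx, inv_one, Octonion.mul_one, Octonion.mul_one]
    rcases Fin.eq_self_or_eq_succAbove i n with rfl | ⟨k, rfl⟩
    · rw [insertOne_self, hx]
    · fin_cases k
      · exact insertOne_succAbove_zero _ _
      · exact insertOne_succAbove_one _ _
  right_inv' p _ := by
    rw [ratio_mk, ratio_mk, insertOne_self, insertOne_succAbove_zero, insertOne_succAbove_one,
      inv_one, Octonion.mul_one, Octonion.mul_one]
  open_source := isOpen_dom i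
  open_target := isOpen_univ
  continuousOn_toFun := (continuousOn_ratio _ _).prodMk (continuousOn_ratio _ _)
  continuousOn_invFun := by
    refine (isQuotientMap_mk.continuous.comp (Continuous.subtype_mk (continuous_pi fun n => ?_)
      fun p => mem_iUnion.2 ⟨i, insertOne_self i p⟩)).continuousOn
    rcases insertOne_cases i n with h | h | h <;> simp only [h] <;> fun_prop

theorem continuous_octChart_symm (i : Fin 3) : Continuous (octChart i).symm :=
  continuousOn_univ.1 (octChart i).continuousOn_symm

theorem octChart_symm_mem_dom {i j : Fin 3} {p : Octonion × Octonion} :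
    (octChart j).symm p ∈ dom i ↔ insertOne j p i ≠ 0 :=
  mk_mem_dom (hx := ⟨j, insertOne_self j p⟩)

/-- The chart `φᵢ : Uᵢ/∼ → ℝ¹⁶`. -/
noncomputable def chart (i : Fin 3) : OpenPartialHomeomorph OP2 (EuclideanSpace ℝ (Fin 16)) :=
  (octChart i).transHomeomorph prodHomeomorph

theorem chart_source (i : Fin 3) : (chart i).source = dom i := rfl

theorem chart_target (i : Fin 3) : (chart i).target = univ := rfl

theorem chart_apply_mk (i : Fin 3) (p : Octonion × Octonion) :
    chart i (OP2.mk (insertOne i p) ⟨i, insertOne_self i p⟩) = toR16 p.1 p.2 :=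
  congrArg prodHomeomorph ((octChart i).right_inv (mem_univ p))

theorem isTransition_chart (i j : Fin 3) :
    IsTransition (chart i) (chart j) (fun a b => insertOne j (a, b) i ≠ 0) fun a b =>
      (insertOne j (a, b) (i.succAbove 0) * (insertOne j (a, b) i)⁻¹,
        insertOne j (a, b) (i.succAbove 1) * (insertOne j (a, b) i)⁻¹) := by
  refine fun a b => ⟨?_, fun _ => rfl⟩
  rw [OpenPartialHomeomorph.trans_source, OpenPartialHomeomorph.symm_source, chart_target,
    univ_inter, mem_preimage, chart_source]
  exact octChart_symm_mem_dom

theorem isContDiffOn_insertOne (i n : Fin 3) (m : WithTop ℕ∞)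
    (s : Set (EuclideanSpace ℝ (Fin 16))) :
    IsContDiffOn m (fun v => insertOne i (leftHalf v, rightHalf v) n) s := by
  rcases insertOne_cases i n with h | h | h <;> simp only [h]
  · exact isContDiffOn_const 1
  · exact isContDiffOn_leftHalf s
  · exact isContDiffOn_rightHalf s

theorem contDiffOn_transition (i j : Fin 3) (m : WithTop ℕ∞) :
    ContDiffOn ℝ m ((chart j).symm.trans (chart i)) ((chart j).symm.trans (chart i)).source := by
  have h0 : ∀ v ∈ ((chart j).symm.trans (chart i)).source,
      insertOne j (leftHalf v, rightHalf v) i ≠ 0 := fun v hv => octChart_symm_mem_dom.1 hv.2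
  have h := (isContDiffOn_insertOne j i m _).inv h0
  exact ((isContDiffOn_insertOne j (i.succAbove 0) m _).mul h).toR16
    ((isContDiffOn_insertOne j (i.succAbove 1) m _).mul h)

/-- The charted space structure given by the three charts. -/
@[reducible]
noncomputable def chartedSpace : ChartedSpace (EuclideanSpace ℝ (Fin 16)) OP2 where
  atlas := range chart
  chartAt p := chart (exists_mem_dom p).choose
  mem_chart_source p := (exists_mem_dom p).choose_spec
  chart_mem_atlas _ := mem_range_self _

theorem isManifold : @IsManifold ℝ _ _ _ _ _ _ (𝓡 16) ∞ OP2 _ chartedSpace := by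
  let _ := chartedSpace
  apply isManifold_of_contDiffOn
  rintro _ _ ⟨i, rfl⟩ ⟨j, rfl⟩
  simpa using contDiffOn_transition j i ∞

/-- The function `|xᵢ|² / (|x₀|² + |x₁|² + |x₂|²)` on the projective plane. -/
noncomputable def weight (i : Fin 3) : OP2 → ℝ :=
  Quotient.lift (fun x : Reduced => normSq (x.1 i) / ∑ j, normSq (x.1 j)) fun x y h => by
    obtain ⟨l, hl, h⟩ := h
    simp only [h, normSq_mul, ← Finset.sum_mul]
    exact mul_div_mul_right _ _ (normSq_ne_zero hl)

theorem sum_normSq_ne_zero {x : Fin 3 → Octonion} (hx : ∃ i, x i = 1) :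
    ∑ j, normSq (x j) ≠ 0 := by
  obtain ⟨i, hi⟩ := hx
  have h := Finset.single_le_sum (f := fun j => normSq (x j)) (fun j _ => normSq_nonneg _)
    (Finset.mem_univ i)
  simp only [hi, normSq_one] at h
  linarith

theorem continuous_weight (i : Fin 3) : Continuous (weight i) := by
  rw [isQuotientMap_mk.continuous_iff]
  exact (continuous_normSq.comp (continuous_entry i)).div
    (continuous_finsetSum _ fun j _ => continuous_normSq.comp (continuous_entry j))
    fun x => sum_normSq_ne_zero (exists_eq_one x)

theorem weight_ne_zero_iff {i : Fin 3} {p : OP2} : weight i p ≠ 0 ↔ p ∈ dom i := by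
  obtain ⟨x, hx, rfl⟩ := p.mk_surjective
  rw [mk_mem_dom]
  change normSq (x i) / ∑ j, normSq (x j) ≠ 0 ↔ _
  rw [Ne, div_eq_zero_iff, or_iff_left (sum_normSq_ne_zero hx)]
  refine ⟨fun h h0 => h (by rw [h0, normSq_zero]), normSq_ne_zero⟩

instance : T2Space OP2 := by
  refine ⟨fun p q hpq => ?_⟩
  obtain ⟨i, hi⟩ := exists_mem_dom p
  by_cases hq : q ∈ dom i
  · have h : chart i p ≠ chart i q := fun h => hpq ((chart i).injOn hi hq h)
    obtain ⟨u, v, hu, hv, hpu, hqv, huv⟩ := t2_separation h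
    refine ⟨_, _, (chart i).isOpen_inter_preimage hu, (chart i).isOpen_inter_preimage hv,
      ⟨hi, hpu⟩, ⟨hq, hqv⟩, ?_⟩
    exact (huv.preimage (chart i)).mono inter_subset_right inter_subset_right
  · have h : weight i p ≠ weight i q := by
      rw [not_not.1 (mt weight_ne_zero_iff.1 hq)]
      exact weight_ne_zero_iff.2 hi
    obtain ⟨u, v, hu, hv, hpu, hqv, huv⟩ := t2_separation h
    exact ⟨_, _, hu.preimage (continuous_weight i), hv.preimage (continuous_weight i), hpu, hqv,
      huv.preimage _⟩

instance : SecondCountableTopology OP2 := by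
  have : ∀ i, SecondCountableTopology (dom i) := fun i =>
    (chart i).toHomeomorphSourceTarget.isEmbedding.secondCountableTopology
  exact TopologicalSpace.secondCountableTopology_of_countable_cover isOpen_dom
    (eq_univ_of_forall fun p => mem_iUnion.2 (exists_mem_dom p))

theorem isSimplyConnected_dom (i : Fin 3) : IsSimplyConnected (dom i) :=
  ((chart i).toHomeomorphSourceTarget.trans
    (Homeomorph.Set.univ _)).toHomotopyEquiv.simplyConnectedSpace

theorem isPathConnected_compl_zero : IsPathConnected ({0}ᶜ : Set Octonion) := by
  have h : IsPathConnected ({0}ᶜ : Set (EuclideanSpace ℝ (Fin 8))) :=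
    isPathConnected_compl_singleton_of_one_lt_rank (by simp [← Module.finrank_eq_rank]) 0
  convert h.image homeomorphEuclidean.symm.continuous using 1
  rw [Homeomorph.image_compl, image_singleton, ← homeomorphEuclidean_zero,
    Homeomorph.symm_apply_apply]

theorem isPathConnected_dom_inter (i j : Fin 3) : IsPathConnected (dom i ∩ dom j) := by
  have h : dom i ∩ dom j = (octChart j).symm '' {p | insertOne j p i ≠ 0} := by
    ext p
    constructor
    · rintro ⟨hi, hj⟩
      have hp := (octChart j).left_inv hj
      exact ⟨octChart j p, octChart_symm_mem_dom.1 (hp.symm ▸ hi), hp⟩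
    · rintro ⟨x, hx, rfl⟩
      exact ⟨octChart_symm_mem_dom.2 hx, (octChart j).map_target (mem_univ x)⟩
  have huniv : IsPathConnected (univ : Set Octonion) := by
    simpa using (isPathConnected_univ (X := EuclideanSpace ℝ (Fin 8))).image
      homeomorphEuclidean.symm.continuous
  rw [h]
  refine IsPathConnected.image ?_ (continuous_octChart_symm j)
  rcases insertOne_cases j i with h | h | h <;> simp only [h]
  · convert huniv.prod huniv using 1
    ext p
    simp [one_ne_zero]
  · convert isPathConnected_compl_zero.prod huniv using 1
    ext p
    simp
  · convert huniv.prod isPathConnected_compl_zero using 1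
    ext p
    simp

instance : SimplyConnectedSpace OP2 :=
  simplyConnectedSpace_of_isOpen_cover isOpen_dom exists_mem_dom isSimplyConnected_dom
    isPathConnected_dom_inter (OP2.mk (fun _ => 1) ⟨0, rfl⟩) fun _ => mk_mem_dom.2 one_ne_zero

end OctPlane

section HomotopyTypes

open Set

/-- A punctured normed space is homotopy equivalent to its unit sphere. -/
noncomputable def complZeroHomotopyEquivSphere (E : Type*) [NormedAddCommGroup E]
    [NormedSpace ℝ E] :
    ContinuousMap.HomotopyEquiv ({0}ᶜ : Set E) (Metric.sphere (0 : E) 1) :=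
  have : ContractibleSpace (Ioi (0 : ℝ)) := (convex_Ioi 0).contractibleSpace ⟨1, mem_Ioi.2 one_pos⟩
  (homeomorphUnitSphereProd E).toHomotopyEquiv.trans
    (((ContinuousMap.HomotopyEquiv.refl _).prodCongr
      (ContractibleSpace.hequiv (Ioi (0 : ℝ)) Unit).some).trans
        (Homeomorph.prodPUnit _).toHomotopyEquiv)

/-- A chart onto the whole model space identifies a subset of its source with the subset of
the model space that parametrizes it. -/
noncomputable def OpenPartialHomeomorph.homeomorphOfSymmMemIff {X Y : Type*} [TopologicalSpace X]
    [TopologicalSpace Y] (e : OpenPartialHomeomorph X Y) (he : e.target = univ) {s : Set X}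
    {t : Set Y} (hs : s ⊆ e.source) (h : ∀ y, e.symm y ∈ s ↔ y ∈ t) : s ≃ₜ t :=
  e.homeomorphOfImageSubsetSource hs <| by
    ext y
    constructor
    · rintro ⟨x, hx, rfl⟩
      rwa [← h, e.left_inv (hs hx)]
    · intro hy
      exact ⟨e.symm y, (h y).2 hy, e.right_inv (he ▸ mem_univ y)⟩

namespace OctPlane

open Octonion

/-- The chart `Uᵢ/∼ → ℝ⁸ × ℝ⁸`. -/
noncomputable def splitChart (i : Fin 3) :
    OpenPartialHomeomorph OP2 (EuclideanSpace ℝ (Fin 8) × EuclideanSpace ℝ (Fin 8)) :=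
  (octChart i).transHomeomorph (homeomorphEuclidean.prodCongr homeomorphEuclidean)

theorem splitChart_symm_mem_dom {i j : Fin 3}
    {v : EuclideanSpace ℝ (Fin 8) × EuclideanSpace ℝ (Fin 8)} :
    (splitChart j).symm v ∈ dom i ↔
      insertOne j (homeomorphEuclidean.symm v.1, homeomorphEuclidean.symm v.2) i ≠ 0 :=
  octChart_symm_mem_dom

theorem homeomorphEuclidean_symm_eq_zero {v : EuclideanSpace ℝ (Fin 8)} :
    homeomorphEuclidean.symm v = 0 ↔ v = 0 := by
  rw [Homeomorph.symm_apply_eq, homeomorphEuclidean_zero]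

theorem nonempty_homotopyEquiv_inter_two :
    Nonempty (ContinuousMap.HomotopyEquiv (dom 0 ∩ dom 1 : Set OP2)
      (Metric.sphere (0 : EuclideanSpace ℝ (Fin 8)) 1 × EuclideanSpace ℝ (Fin 8))) := by
  let e : (dom 0 ∩ dom 1 : Set OP2) ≃ₜ ({0}ᶜ ×ˢ univ : Set (EuclideanSpace ℝ (Fin 8) ×
      EuclideanSpace ℝ (Fin 8))) :=
    (splitChart 0).homeomorphOfSymmMemIff rfl inter_subset_left fun v => by
      simp [splitChart_symm_mem_dom, insertOne_zero, one_ne_zero, homeomorphEuclidean_symm_eq_zero]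
  exact ⟨(e.trans (Homeomorph.Set.prod _ _)).toHomotopyEquiv.trans
    ((complZeroHomotopyEquivSphere _).prodCongr (Homeomorph.Set.univ _).toHomotopyEquiv)⟩

theorem nonempty_homotopyEquiv_inter_three :
    Nonempty (ContinuousMap.HomotopyEquiv (dom 0 ∩ dom 1 ∩ dom 2 : Set OP2)
      (Metric.sphere (0 : EuclideanSpace ℝ (Fin 8)) 1 ×
        Metric.sphere (0 : EuclideanSpace ℝ (Fin 8)) 1)) := by
  let e : (dom 0 ∩ dom 1 ∩ dom 2 : Set OP2) ≃ₜ ({0}ᶜ ×ˢ {0}ᶜ : Set (EuclideanSpace ℝ (Fin 8) ×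
      EuclideanSpace ℝ (Fin 8))) :=
    (splitChart 0).homeomorphOfSymmMemIff rfl (inter_subset_left.trans inter_subset_left)
      fun v => by
        simp [splitChart_symm_mem_dom, insertOne_zero, one_ne_zero,
          homeomorphEuclidean_symm_eq_zero]
  exact ⟨(e.trans (Homeomorph.Set.prod _ _)).toHomotopyEquiv.trans
    ((complZeroHomotopyEquivSphere _).prodCongr (complZeroHomotopyEquivSphere _))⟩

theorem nonempty_homotopyEquiv_union_inter :
    Nonempty (ContinuousMap.HomotopyEquiv ((dom 0 ∪ dom 1) ∩ dom 2 : Set OP2)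
      (Metric.sphere (0 : EuclideanSpace ℝ (Fin 16)) 1)) := by
  have hmem : ∀ i v, (chart 2).symm v ∈ dom i ↔ insertOne 2 (leftHalf v, rightHalf v) i ≠ 0 :=
    fun i v => octChart_symm_mem_dom
  let e : ((dom 0 ∪ dom 1) ∩ dom 2 : Set OP2) ≃ₜ ({0}ᶜ : Set (EuclideanSpace ℝ (Fin 16))) :=
    (chart 2).homeomorphOfSymmMemIff rfl inter_subset_right fun v => by
      have hv : (leftHalf v = 0 ∧ rightHalf v = 0) ↔ v = 0 := by
        rw [← Prod.mk_inj, ← prodHomeomorph_zero, ← Homeomorph.symm_apply_eq]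
        rfl
      simp [hmem, insertOne_two, one_ne_zero, ← hv, imp_iff_not_or]
  exact ⟨e.toHomotopyEquiv.trans (complZeroHomotopyEquivSphere _)⟩

end OctPlane

end HomotopyTypes

theorem mainTheorem7 :
    -- the three charts `φᵢ : Uᵢ/∼ → ℝ¹⁶`, homeomorphisms from open sets onto `ℝ¹⁶`
    (∃ φ : Fin 3 → OpenPartialHomeomorph OP2 (EuclideanSpace ℝ (Fin 16)),
      (∀ i, (φ i).source = dom i) ∧ (∀ i, (φ i).target = Set.univ) ∧
      (∀ b c : Octonion, φ 0 (OP2.mk ![1, b, c] ⟨0, rfl⟩) = toR16 b c) ∧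
      (∀ a c : Octonion, φ 1 (OP2.mk ![a, 1, c] ⟨1, rfl⟩) = toR16 a c) ∧
      (∀ a b : Octonion, φ 2 (OP2.mk ![a, b, 1] ⟨2, rfl⟩) = toR16 a b) ∧
      -- the transition functions `φᵢ ∘ φⱼ⁻¹`
      IsTransition (φ 0) (φ 1) (fun a _ => a ≠ 0) (fun a b => (a⁻¹, b * a⁻¹)) ∧
      IsTransition (φ 1) (φ 0) (fun a _ => a ≠ 0) (fun a b => (a⁻¹, b * a⁻¹)) ∧
      IsTransition (φ 0) (φ 2) (fun a _ => a ≠ 0) (fun a b => (b * a⁻¹, a⁻¹)) ∧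
      IsTransition (φ 2) (φ 0) (fun _ b => b ≠ 0) (fun a b => (b⁻¹, a * b⁻¹)) ∧
      IsTransition (φ 1) (φ 2) (fun _ b => b ≠ 0) (fun a b => (a * b⁻¹, b⁻¹)) ∧
      IsTransition (φ 2) (φ 1) (fun _ b => b ≠ 0) (fun a b => (a * b⁻¹, b⁻¹)) ∧
      -- they form an atlas of a smooth 16-dimensional manifold
      ∃ _ : ChartedSpace (EuclideanSpace ℝ (Fin 16)) OP2,
        atlas (EuclideanSpace ℝ (Fin 16)) OP2 = Set.range φ ∧ IsManifold (𝓡 16) ∞ OP2) ∧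
    T2Space OP2 ∧ SecondCountableTopology OP2 ∧
    SimplyConnectedSpace OP2 ∧
    -- homotopy types of the overlaps of the chart domains
    Nonempty (ContinuousMap.HomotopyEquiv (dom 0 ∩ dom 1 : Set OP2)
      (Metric.sphere (0 : EuclideanSpace ℝ (Fin 8)) 1 × EuclideanSpace ℝ (Fin 8))) ∧
    Nonempty (ContinuousMap.HomotopyEquiv (dom 0 ∩ dom 1 ∩ dom 2 : Set OP2)
      (Metric.sphere (0 : EuclideanSpace ℝ (Fin 8)) 1 ×
        Metric.sphere (0 : EuclideanSpace ℝ (Fin 8)) 1)) ∧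
    Nonempty (ContinuousMap.HomotopyEquiv ((dom 0 ∪ dom 1) ∩ dom 2 : Set OP2)
      (Metric.sphere (0 : EuclideanSpace ℝ (Fin 16)) 1)) := by
  refine ⟨⟨chart, chart_source, chart_target, fun b c => ?_, fun a c => ?_, fun a b => ?_,
    ?_, ?_, ?_, ?_, ?_, ?_, chartedSpace, rfl, isManifold⟩, inferInstance, inferInstance,
    inferInstance, nonempty_homotopyEquiv_inter_two, nonempty_homotopyEquiv_inter_three,
    nonempty_homotopyEquiv_union_inter⟩
  · simpa only [insertOne_zero] using chart_apply_mk 0 (b, c)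
  · simpa only [insertOne_one] using chart_apply_mk 1 (a, c)
  · simpa only [insertOne_two] using chart_apply_mk 2 (a, b)
  · simpa [insertOne_one, Octonion.one_mul, Fin.succAbove] using isTransition_chart 0 1
  · simpa [insertOne_zero, Octonion.one_mul, Fin.succAbove] using isTransition_chart 1 0
  · simpa [insertOne_two, Octonion.one_mul, Fin.succAbove] using isTransition_chart 0 2
  · simpa [insertOne_zero, Octonion.one_mul, Fin.succAbove] using isTransition_chart 2 0
  · simpa [insertOne_two, Octonion.one_mul, Fin.succAbove] using isTransition_chart 1 2
  · simpa [insertOne_one, Octonion.one_mul, Fin.succAbove] using isTransition_chart 2 1
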